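/- \textbf{Setting.} Let $M$ be a compact smooth Riemannian manifold (without boundary), $f\in\mathrm{Diff}^2(M)$, let $\mathcal T$ be a metric space and $\omega\mapsto f_\omega$ a continuous map $\mathcal T\to \mathrm{Diff}^2(M)$ (with the $C^2$ topology) such that $f_{\omega_f}=f$ for some $\omega_f\in\mathcal T$. Let $(\theta_\varepsilon)_{\varepsilon>0}$ be Borel probability measures on $\mathcal T$ whose supports are nested compact sets converging to $\{\omega_f\}$ as $\varepsilon\to0$, and put $\Omega_\varepsilon=\mathrm{supp}(\theta_\varepsilon^{\mathbb Z})\subset\mathcal T^{\mathbb Z}$. Let $\sigma$ be the left shift on $\mathcal T^{\mathbb Z}$ and $$\mathcal F(\underline\omega,x)=(\sigma\underline\omega,f_{\omega_0}(x))\quad\text{on }\mathcal T^{\mathbb Z}\times M,$$ and write $f^n_{\underline\omega}=f_{\omega_{n-1}}\circ\cdots\circ f_{\omega_0}$ for $n>0$, $f^0_{\underline\omega}=\mathrm{id}$, $f^n_{\underline\omega}=f^{-1}_{\omega_{n}}\circ\cdots\circ f^{-1}_{\omega_{-1}}$ for $n<0$. Let $\varepsilon_0>0$ be a noise level for which there is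 a random dominated splitting $T_xM=E^{cu}(\underline\omega,x)\oplus E^{cs}(\underline\omega,x)$ over $(\underline\omega,x)\in\Omega_{\varepsilon_0}\times M$, and fix one; that is, both subbundles depend continuously on $(\underline\omega,x)$, are invariant ($Df_{\omega_0}E^{*}(\underline\omega,x)=E^{*}(\mathcal F(\underline\omega,x))$ for $*=cu,cs$), and there are $C$ and $\lambda\in(0,1)$ with $$\|Df^n_{\underline\omega}|_{E^{cs}(\underline\omega,x)}\|\cdot\|Df^{-n}_{\sigma^n\underline\omega}|_{E^{cu}(\mathcal F^n(\underline\omega,x))}\|\le C\lambda^n$$ for all $(\underline\omega,x)\in\Omega_{\varepsilon_0}\times M$ and all $n\ge 0$. For $\alpha>0$ and $\ell\in\mathbb N$ let $\mathcal B_\ell(\alpha)$ be the set of all $(\underline\omega,x)\in\Omega_{\varepsilon_0}\times M$ such that for all $n\in\mathbb N$ $$\prod_{i=0}^{n-1}\big\|Df^{\ell}_{\sigma^{i\ell}\underline\omega}|_{E^{cs}(\mathcal F^{i\ell}(\underline\omega,x))}\big\|\le e^{-\alpha\ell n},\qquad \prod_{i=0}^{n-1}\big\|Df^{-\ell}_{\sigma^{-i\ell}\underline\omega}|_{E^{cu}(\mathcal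 F^{-i\ell}(\underline\omega,x))}\big\|\le e^{-\alpha\ell n}.$$ \textbf{Theorem.} Let $0<\alpha<\beta$, and let $(\mu_n)$ be a sequence of $\mathcal F$-invariant Borel probability measures on $\mathcal T^{\mathbb Z}\times M$, each giving full measure to $\Omega_{\varepsilon_0}\times M$, that converges weakly to a probability measure $\mu$. Suppose that for $\mu$-almost every $(\underline\omega,x)$ the limits below exist (in $[-\infty,\infty]$, with $\log 0=-\infty$) and satisfy $$\lim_{n\to+\infty}\frac1n\log\|Df^n_{\underline\omega}|_{E^{cs}(\underline\omega,x)}\|<-\beta,\qquad \lim_{n\to+\infty}\frac1n\log\|Df^{-n}_{\underline\omega}|_{E^{cu}(\underline\omega,x)}\|<-\beta .$$ Then $$\lim_{\ell\to+\infty}\ \liminf_{n\to+\infty}\ \mu_n(\mathcal B_\ell(\alpha))=1 .$$ -/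

import Mathlib

open Bundle Set Filter MeasureTheory
open scoped Manifold ContDiff Topology ENNReal

noncomputable section

namespace RandomPert

section Diff

variable {E : Type*} [NormedAddCommGroup E] [NormedSpace ℝ E]
  {M : Type*} [TopologicalSpace M] [ChartedSpace E M] [IsManifold 𝓘(ℝ, E) ∞ M]

/-- The second tangent map `T(Tf) : TTM → TTM` of a `C²` diffeomorphism `f`, as a continuous map. -/
def secondTangentMap (f : M ≃ₘ^2⟮𝓘(ℝ, E), 𝓘(ℝ, E)⟯ M) :
    C(TangentBundle 𝓘(ℝ, E).tangent (TangentBundle 𝓘(ℝ, E) M),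
      TangentBundle 𝓘(ℝ, E).tangent (TangentBundle 𝓘(ℝ, E) M)) where
  toFun := tangentMap 𝓘(ℝ, E).tangent 𝓘(ℝ, E).tangent (tangentMap 𝓘(ℝ, E) 𝓘(ℝ, E) f)
  continuous_toFun :=
    ContMDiff.continuous_tangentMap (n := 1)
      (ContMDiff.contMDiff_tangentMap (n := 2) f.contMDiff_toFun (by norm_num)) le_rfl

/-- The `C²` topology on `Diff²(M)`: uniform convergence on compact sets of the map together with
its derivatives of order at most two, expressed by the compact-open topology on second tangent
maps. -/
instance diffTopology : TopologicalSpace (M ≃ₘ^2⟮𝓘(ℝ, E), 𝓘(ℝ, E)⟯ M) :=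
  TopologicalSpace.induced secondTangentMap inferInstance

end Diff

section Noise

variable {T : Type*} [MetricSpace T] [MeasurableSpace T] [BorelSpace T]

/-- `Ω_ε = supp (θ_ε^ℤ)`, a subset of `T^ℤ`. -/
def noiseSpace (θ : ℝ → ProbabilityMeasure T) (ε : ℝ) : Set (ℤ → T) :=
  (Measure.infinitePi (fun _ : ℤ => (θ ε : Measure T))).support

variable {E : Type*} [NormedAddCommGroup E] [NormedSpace ℝ E]
  {M : Type*} [TopologicalSpace M] [ChartedSpace E M] [IsManifold 𝓘(ℝ, E) ∞ M]

/-- `(Φ, (θ_ε)_{ε > 0})` is a random perturbation of `f`: `ω ↦ f_ω = Φ ω` is a continuous map into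
`Diff²(M)` with `f_{ω_f} = f`, and the supports of the probability measures `θ_ε` are nested
compact sets converging to `{ω_f}` as `ε → 0`. Only the values `θ ε` with `ε > 0` matter. -/
structure IsRandomPerturbation (f : M ≃ₘ^2⟮𝓘(ℝ, E), 𝓘(ℝ, E)⟯ M)
    (Φ : T → (M ≃ₘ^2⟮𝓘(ℝ, E), 𝓘(ℝ, E)⟯ M)) (ωf : T) (θ : ℝ → ProbabilityMeasure T) : Prop where
  continuous : Continuous Φ
  base : Φ ωf = f
  isCompact_support : ∀ ε, 0 < ε → IsCompact (θ ε : Measure T).support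
  nested : ∀ ε ε', 0 < ε → ε ≤ ε' → (θ ε : Measure T).support ⊆ (θ ε' : Measure T).support
  shrink : ∀ U ∈ 𝓝 ωf, ∀ᶠ ε in 𝓝[>] (0 : ℝ),
    (θ ε : Measure T).support.Nonempty ∧ (θ ε : Measure T).support ⊆ U

end Noise

section Product

/-- The product space `T^ℤ × M` of pairs `(ω, x)`, with `ω = noise` and `x = pt`. It carries the
product topology and the corresponding Borel `σ`-algebra. -/
@[ext] structure ProdSpace (T M : Type*) where
  noise : ℤ → T
  pt : M

variable {T : Type*} {M : Type*}

instance [TopologicalSpace T] [TopologicalSpace M] : TopologicalSpace (ProdSpace T M) :=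
  TopologicalSpace.induced (fun z => (z.noise, z.pt)) inferInstance

instance [TopologicalSpace T] [TopologicalSpace M] : MeasurableSpace (ProdSpace T M) :=
  borel (ProdSpace T M)

instance [TopologicalSpace T] [TopologicalSpace M] : BorelSpace (ProdSpace T M) := ⟨rfl⟩

/-- The subset `Ω × M` of `T^ℤ × M`. -/
def fiberOver (Ω : Set (ℤ → T)) : Set (ProdSpace T M) := {z | z.noise ∈ Ω}

variable {E : Type*} [NormedAddCommGroup E] [NormedSpace ℝ E]
  [TopologicalSpace M] [ChartedSpace E M]

/-- The skew product `ℱ (ω, x) = (σ ω, f_{ω_0} x)` on `T^ℤ × M`, where `σ` is the left shift,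
together with its inverse. -/
def skew (Φ : T → (M ≃ₘ^2⟮𝓘(ℝ, E), 𝓘(ℝ, E)⟯ M)) : Equiv.Perm (ProdSpace T M) where
  toFun z := ⟨fun i => z.noise (i + 1), Φ (z.noise 0) z.pt⟩
  invFun z := ⟨fun i => z.noise (i - 1), (Φ (z.noise (-1))).symm z.pt⟩
  left_inv z := by simp
  right_inv z := by simp

/-- `f_ω^n = f_{ω_{n-1}} ∘ ⋯ ∘ f_{ω_0}` for `n ≥ 0`. -/
def iterFwd (Φ : T → (M ≃ₘ^2⟮𝓘(ℝ, E), 𝓘(ℝ, E)⟯ M)) (w : ℤ → T) : ℕ → M → M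
  | 0 => id
  | n + 1 => Φ (w n) ∘ iterFwd Φ w n

/-- `f_ω^{-n} = f_{ω_{-n}}⁻¹ ∘ ⋯ ∘ f_{ω_{-1}}⁻¹` for `n ≥ 0`. -/
def iterBwd (Φ : T → (M ≃ₘ^2⟮𝓘(ℝ, E), 𝓘(ℝ, E)⟯ M)) (w : ℤ → T) : ℕ → M → M
  | 0 => id
  | n + 1 => (Φ (w (-((n : ℤ) + 1)))).symm ∘ iterBwd Φ w n

/-- `f_ω^n` for `n ∈ ℤ`. -/
def iter (Φ : T → (M ≃ₘ^2⟮𝓘(ℝ, E), 𝓘(ℝ, E)⟯ M)) (w : ℤ → T) : ℤ → M → M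
  | Int.ofNat n => iterFwd Φ w n
  | Int.negSucc n => iterBwd Φ w (n + 1)

/-- A field of tangent subspaces `G(ω, x) ⊆ T_x M` indexed by `(ω, x) ∈ T^ℤ × M`. -/
abbrev SubspaceField (E T M : Type*) [NormedAddCommGroup E] [NormedSpace ℝ E]
    [TopologicalSpace M] [ChartedSpace E M] : Type _ :=
  ∀ z : ProdSpace T M, Submodule ℝ (TangentSpace 𝓘(ℝ, E) z.pt)

/-- Continuity over `S` of a field of tangent subspaces: near every point of `S` it is spanned by a
continuous frame. -/
def SubspaceField.IsContinuousOn [IsManifold 𝓘(ℝ, E) ∞ M] [TopologicalSpace T]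
    (G : SubspaceField E T M) (S : Set (ProdSpace T M)) : Prop :=
  ∀ z₀ ∈ S, ∃ U ∈ 𝓝 z₀, ∃ (k : ℕ)
    (e : Fin k → ∀ z : ProdSpace T M, TangentSpace 𝓘(ℝ, E) z.pt),
    (∀ i, ContinuousOn (fun z => (⟨z.pt, e i z⟩ : TangentBundle 𝓘(ℝ, E) M)) (U ∩ S)) ∧
    ∀ z ∈ U ∩ S, LinearIndependent ℝ (fun i => e i z) ∧
      Submodule.span ℝ (Set.range fun i => e i z) = G z

variable [RiemannianBundle (fun x : M => TangentSpace 𝓘(ℝ, E) x)]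

/-- The operator norm `‖Df_ω^n |_{G(ω, x)}‖`, for `n ∈ ℤ` and `z = (ω, x)`, with respect to the
Riemannian metric of `M`. -/
def restrNorm (Φ : T → (M ≃ₘ^2⟮𝓘(ℝ, E), 𝓘(ℝ, E)⟯ M)) (G : SubspaceField E T M) (n : ℤ)
    (z : ProdSpace T M) : ℝ :=
  ‖(mfderiv 𝓘(ℝ, E) 𝓘(ℝ, E) (iter Φ z.noise n) z.pt).comp (G z).subtypeL‖

/-- `E^cu ⊕ E^cs` is a random dominated splitting over `Ω × M`: a continuous splitting of the
tangent spaces, invariant under the derivative cocycle, such that `E^cu` dominates `E^cs`. -/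
structure IsRandomDominatedSplitting [IsManifold 𝓘(ℝ, E) ∞ M] [TopologicalSpace T]
    (Φ : T → (M ≃ₘ^2⟮𝓘(ℝ, E), 𝓘(ℝ, E)⟯ M)) (Ω : Set (ℤ → T))
    (Ecu Ecs : SubspaceField E T M) : Prop where
  isCompl : ∀ z ∈ fiberOver (M := M) Ω, IsCompl (Ecu z) (Ecs z)
  invariant_cu : ∀ z ∈ fiberOver (M := M) Ω,
    (Ecu z).map (mfderiv 𝓘(ℝ, E) 𝓘(ℝ, E) (Φ (z.noise 0)) z.pt).toLinearMap = Ecu (skew Φ z)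
  invariant_cs : ∀ z ∈ fiberOver (M := M) Ω,
    (Ecs z).map (mfderiv 𝓘(ℝ, E) 𝓘(ℝ, E) (Φ (z.noise 0)) z.pt).toLinearMap = Ecs (skew Φ z)
  continuous_cu : Ecu.IsContinuousOn (fiberOver Ω)
  continuous_cs : Ecs.IsContinuousOn (fiberOver Ω)
  dominated : ∃ C lam : ℝ, 0 < lam ∧ lam < 1 ∧ ∀ z ∈ fiberOver (M := M) Ω, ∀ n : ℕ,
    restrNorm Φ Ecs n z * restrNorm Φ Ecu (-n) ((skew Φ ^ n) z) ≤ C * lam ^ n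

/-- The hyperbolic block `𝓑_ℓ(α)` of level `ℓ`. -/
def hypBlock (Φ : T → (M ≃ₘ^2⟮𝓘(ℝ, E), 𝓘(ℝ, E)⟯ M)) (Ω : Set (ℤ → T))
    (Ecu Ecs : SubspaceField E T M) (α : ℝ) (ℓ : ℕ) : Set (ProdSpace T M) :=
  {z | z ∈ fiberOver (M := M) Ω ∧ ∀ n : ℕ,
    (∏ i ∈ Finset.range n, restrNorm Φ Ecs (ℓ : ℤ) ((skew Φ ^ ((i : ℤ) * ℓ)) z)
        ≤ Real.exp (-α * ℓ * n)) ∧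
    (∏ i ∈ Finset.range n, restrNorm Φ Ecu (-(ℓ : ℤ)) ((skew Φ ^ (-((i : ℤ) * ℓ))) z)
        ≤ Real.exp (-α * ℓ * n))}

/-- The limit `lim_{n → ∞} (1/n) log a_n` exists in `[-∞, ∞]` and is smaller than `b`; here
`log 0 = -∞`. -/
def ExpRateLT (a : ℕ → ℝ) (b : ℝ) : Prop :=
  ∃ c : EReal, c < (b : EReal) ∧
    Tendsto (fun n : ℕ => (((1 : ℝ) / n : ℝ) : EReal) * ENNReal.log (ENNReal.ofReal (a n)))
      atTop (𝓝 c)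

end Product

end RandomPert

end

/-! Call a point bad at level ℓ if `Df^ℓ` sends some unit vector of E^cs, or `Df^{-ℓ}` some unit
vector of E^cu, to a vector of norm at least e^{-βℓ}; let D_ℓ be the set of bad points. The rate
hypothesis says that μ-almost every point lies outside D_ℓ for all large ℓ, so μ(D_ℓ) → 0.

D_ℓ is compact (`isCompact_badSet`), because the subbundles are closed and the derivative cocycle is
continuous. The portmanteau inequality then gives limsup μ_n(D_ℓ) ≤ μ(D_ℓ).

It remains to control whole orbits under each μ_n. With L a common bound for the norms of all
Df_ω^{±1}, the logarithm of the restricted norm of `Df^{±ℓ}` is at most ℓ((log L + β)1_{D_ℓ} − β).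
Hence the products defining the block are at most e^{-αℓn} as soon as every Birkhoff sum of (log L +
β)1_{D_ℓ} − (β − α) under ℱ^{±ℓ} is nonpositive (`prod_restrNorm_le`). By the maximal inequality
(`measure_exists_birkhoffSum_indicator_pos_le`) this fails, in each time direction, on a set of
μ_n-measure at most (log L + β)/(β − α) · μ_n(D_ℓ). The factor depends on neither ℓ nor n, so
letting n and then ℓ tend to infinity proves the claim. -/

/-! ### Maximal inequalities for measure-preserving maps. -/

/-- The maximal ergodic theorem (Hopf, Garsia). -/
theorem setIntegral_nonneg_of_exists_birkhoffSum_pos {α : Type*} [MeasurableSpace α]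
    {μ : Measure α} {S : α → α} (hS : MeasurePreserving S μ μ) {h : α → ℝ}
    (hm : Measurable h) (hint : Integrable h μ) :
    0 ≤ ∫ x in {x | ∃ n, 0 < birkhoffSum S h n x}, h x ∂μ := by
  -- `m n` is the maximum of the Birkhoff sums of lengths 0, …, n, written recursively by
  -- conditioning on the first step.
  let m : ℕ → α → ℝ := fun n => Nat.rec (fun _ => 0) (fun _ g x => max 0 (h x + g (S x))) n
  have m0 : ∀ x, m 0 x = 0 := fun x => rfl
  have ms : ∀ n x, m (n + 1) x = max 0 (h x + m n (S x)) := fun n x => rfl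
  have nonneg : ∀ n x, 0 ≤ m n x := by
    rintro (_ | n) x
    · exact le_rfl
    · exact le_max_left _ _
  have step : ∀ n x, m n x ≤ m (n + 1) x := by
    intro n
    induction n with
    | zero => intro x; exact nonneg 1 x
    | succ n ih =>
      intro x
      rw [ms, ms (n + 1)]
      exact max_le_max le_rfl (by linarith [ih (S x)])
  have meas : ∀ n, Measurable (m n) := by
    intro n
    induction n with
    | zero => exact measurable_const
    | succ n ih => exact measurable_const.max (hm.add (ih.comp hS.measurable))
  have integ : ∀ n, Integrable (m n) μ := by
    intro n
    induction n with
    | zero => exact integrable_zero _ _ _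
    | succ n ih =>
      exact (integrable_zero _ _ _).sup (hint.add (hS.integrable_comp_of_integrable ih))
  have hset : {x | ∃ n, 0 < birkhoffSum S h n x} = ⋃ n, {x | 0 < m n x} := by
    have h1 : ∀ n x, birkhoffSum S h n x ≤ m n x := by
      intro n
      induction n with
      | zero => intro x; simp [m0]
      | succ n ih =>
        intro x
        rw [birkhoffSum_succ', ms]
        exact le_max_of_le_right (by linarith [ih (S x)])
    have h2 : ∀ n x, 0 < m n x → ∃ k, m n x ≤ birkhoffSum S h k x := by
      intro n
      induction n with
      | zero => intro x hx; simp [m0] at hx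
      | succ n ih =>
        intro x hx
        have hx' : m (n + 1) x = h x + m n (S x) := by
          rw [ms] at hx ⊢
          exact max_eq_right (by by_contra hc; rw [max_eq_left (not_le.1 hc).le] at hx; simp at hx)
        rcases (nonneg n (S x)).eq_or_lt with h0 | h0
        · exact ⟨1, by rw [hx', ← h0]; simp⟩
        · obtain ⟨k, hk⟩ := ih _ h0
          exact ⟨k + 1, by rw [hx', birkhoffSum_succ']; linarith⟩
    ext x
    simp only [mem_ofPred_eq, mem_iUnion]
    constructor
    · rintro ⟨n, hn⟩
      exact ⟨n, hn.trans_le (h1 n x)⟩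
    · rintro ⟨n, hn⟩
      obtain ⟨k, hk⟩ := h2 n x hn
      exact ⟨k, hn.trans_le hk⟩
  have hA : ∀ n, MeasurableSet {x | 0 < m n x} := fun n =>
    measurableSet_lt measurable_const (meas n)
  have hmono : Monotone fun n => {x | 0 < m n x} :=
    monotone_nat_of_le_succ fun n x hx => lt_of_lt_of_le hx (step n x)
  rw [hset]
  refine ge_of_tendsto' (tendsto_setIntegral_of_monotone hA hmono hint.integrableOn) fun n => ?_
  have hcomp : Integrable (fun x => m n (S x)) μ := hS.integrable_comp_of_integrable (integ n)
  -- Where `m (n + 1)` is positive it equals h + `m n` ∘ S, which is at most h + `m (n + 1)` ∘ S by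
  -- monotonicity in n.
  have hle : ∫ x in {x | 0 < m n x}, (m n x - m n (S x)) ∂μ ≤ ∫ x in {x | 0 < m n x}, h x ∂μ := by
    refine setIntegral_mono_on ((integ n).sub hcomp).integrableOn hint.integrableOn (hA n) ?_
    intro x hx
    rcases n with _ | n
    · simp [m0] at hx
    · have hx' : 0 < max 0 (h x + m n (S x)) := hx
      have : m (n + 1) x = h x + m n (S x) := by
        rw [ms]
        exact max_eq_right (by by_contra hc; rw [max_eq_left (not_le.1 hc).le] at hx'; simp at hx')
      linarith [step n (S x)]
  refine le_trans ?_ hle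
  rw [integral_sub (integ n).integrableOn hcomp.integrableOn]
  -- `m n` vanishes off the set of integration, while `m n` ∘ S is only nonnegative there;
  -- invariance makes the two full integrals equal, so the difference is nonnegative.
  have e1 : ∫ x in {x | 0 < m n x}, m n x ∂μ = ∫ x, m n x ∂μ := by
    refine setIntegral_eq_integral_of_forall_compl_eq_zero fun x hx => ?_
    exact le_antisymm (not_lt.1 hx) (nonneg n x)
  have e2 : ∫ x in {x | 0 < m n x}, m n (S x) ∂μ ≤ ∫ x, m n (S x) ∂μ :=
    setIntegral_le_integral hcomp (Eventually.of_forall fun x => nonneg n _)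
  have e3 : ∫ x, m n (S x) ∂μ = ∫ x, m n x ∂μ := by
    have := integral_map hS.measurable.aemeasurable (μ := μ) (f := m n)
      (meas n).aestronglyMeasurable
    rw [hS.map_eq] at this
    exact this.symm
  linarith

/-- The weak type maximal inequality for the frequency of visits to a set `D`. -/
theorem measure_exists_birkhoffSum_indicator_pos_le {α : Type*} [MeasurableSpace α]
    {μ : Measure α} [IsFiniteMeasure μ] {S : α → α} (hS : MeasurePreserving S μ μ) {D : Set α}
    (hD : MeasurableSet D) {a b : ℝ} (ha : 0 < a) (hb : 0 ≤ b) :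
    μ {x | ∃ n, 0 < birkhoffSum S (fun y => D.indicator (fun _ => b) y - a) n x}
      ≤ ENNReal.ofReal (b / a) * μ D := by
  set N := {x | ∃ n, 0 < birkhoffSum S (fun y => D.indicator (fun _ => b) y - a) n x}
  have hi : Integrable (D.indicator fun _ => b) μ := (integrable_const b).indicator hD
  have key := setIntegral_nonneg_of_exists_birkhoffSum_pos hS
    (h := fun y => D.indicator (fun _ => b) y - a)
    ((measurable_const.indicator hD).sub measurable_const) (hi.sub (integrable_const a))
  change 0 ≤ ∫ x in N, _ ∂μ at key
  rw [integral_sub hi.integrableOn (integrable_const a).integrableOn,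
    setIntegral_const, setIntegral_indicator hD, setIntegral_const, smul_eq_mul, smul_eq_mul] at key
  have h1 : μ.real (N ∩ D) ≤ μ.real D := measureReal_mono inter_subset_right
  have h2 : μ.real N ≤ b / a * μ.real D := by
    rw [div_mul_eq_mul_div, le_div_iff₀ ha]
    nlinarith
  rw [← ENNReal.ofReal_toReal (measure_ne_top μ N), ← ENNReal.ofReal_toReal (measure_ne_top μ D),
    ← ENNReal.ofReal_mul (div_nonneg hb ha.le)]
  exact ENNReal.ofReal_le_ofReal h2

/-! ### The derivative cocycle and closedness of the subbundles. -/

namespace RandomPert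

section
variable {E : Type*} [NormedAddCommGroup E] [NormedSpace ℝ E]
  {M : Type*} [TopologicalSpace M] [ChartedSpace E M]
  {T : Type*}

/-- The family of tangent maps of a continuous family of `C²` diffeomorphisms is jointly
continuous. -/
theorem continuous_tangentMap_family [IsManifold 𝓘(ℝ, E) ∞ M] [FiniteDimensional ℝ E]
    [TopologicalSpace T] {Φ : T → (M ≃ₘ^2⟮𝓘(ℝ, E), 𝓘(ℝ, E)⟯ M)} (hΦ : Continuous Φ) :
    Continuous fun p : T × TangentBundle 𝓘(ℝ, E) M =>
      tangentMap 𝓘(ℝ, E) 𝓘(ℝ, E) (Φ p.1) p.2 := by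
  have : LocallyCompactSpace (TangentBundle 𝓘(ℝ, E) M) :=
    Manifold.locallyCompact_of_finiteDimensional 𝓘(ℝ, E).tangent
  have : LocallyCompactSpace (TangentBundle 𝓘(ℝ, E).tangent (TangentBundle 𝓘(ℝ, E) M)) :=
    Manifold.locallyCompact_of_finiteDimensional 𝓘(ℝ, E).tangent.tangent
  have h1 : Continuous fun a => secondTangentMap (Φ a) := continuous_induced_dom.comp hΦ
  -- The second tangent map at the zero vector over v projects to Tf(v), so joint continuity of
  -- evaluation in the C² topology descends to first tangent maps.
  have h2 : Continuous fun v : TangentBundle 𝓘(ℝ, E) M =>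
      (⟨v, 0⟩ : TangentBundle 𝓘(ℝ, E).tangent (TangentBundle 𝓘(ℝ, E) M)) :=
    (Bundle.contMDiff_zeroSection (n := 0) (IB := 𝓘(ℝ, E).tangent) ℝ
      (TangentSpace 𝓘(ℝ, E).tangent : TangentBundle 𝓘(ℝ, E) M → Type _)).continuous
  exact (FiberBundle.continuous_proj _ _).comp
    ((h1.comp continuous_fst).eval (h2.comp continuous_snd))

theorem continuous_eval_family [IsManifold 𝓘(ℝ, E) ∞ M] [FiniteDimensional ℝ E]
    [TopologicalSpace T] {Φ : T → (M ≃ₘ^2⟮𝓘(ℝ, E), 𝓘(ℝ, E)⟯ M)} (hΦ : Continuous Φ) :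
    Continuous fun p : T × M => Φ p.1 p.2 := by
  have h2 : Continuous fun v : M => (⟨v, 0⟩ : TangentBundle 𝓘(ℝ, E) M) :=
    (Bundle.contMDiff_zeroSection (n := 0) (IB := 𝓘(ℝ, E)) ℝ
      (TangentSpace 𝓘(ℝ, E) : M → Type _)).continuous
  exact (FiberBundle.continuous_proj _ _).comp
    ((continuous_tangentMap_family hΦ).comp (continuous_fst.prodMk (h2.comp continuous_snd)))

theorem tangentMap_symm_tangentMap (g : M ≃ₘ^2⟮𝓘(ℝ, E), 𝓘(ℝ, E)⟯ M)
    (v : TangentBundle 𝓘(ℝ, E) M) :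
    tangentMap 𝓘(ℝ, E) 𝓘(ℝ, E) g.symm (tangentMap 𝓘(ℝ, E) 𝓘(ℝ, E) g v) = v := by
  have h := tangentMap_comp (g.symm.contMDiff.mdifferentiable two_ne_zero)
    (g.contMDiff.mdifferentiable two_ne_zero)
  have h2 : (g.symm ∘ g : M → M) = id := by ext x; simp
  rw [h2, tangentMap_id] at h
  exact (congrFun h v).symm

/-- The derivative cocycle on `T^ℤ × TM` over the skew product. -/
@[simps] noncomputable def tangentSkew (Φ : T → (M ≃ₘ^2⟮𝓘(ℝ, E), 𝓘(ℝ, E)⟯ M)) :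
    Equiv.Perm ((ℤ → T) × TangentBundle 𝓘(ℝ, E) M) where
  toFun p := (fun i => p.1 (i + 1), tangentMap 𝓘(ℝ, E) 𝓘(ℝ, E) (Φ (p.1 0)) p.2)
  invFun p := (fun i => p.1 (i - 1), tangentMap 𝓘(ℝ, E) 𝓘(ℝ, E) (Φ (p.1 (-1))).symm p.2)
  left_inv p := by simp [tangentMap_symm_tangentMap]
  right_inv p := by
    have h : tangentMap 𝓘(ℝ, E) 𝓘(ℝ, E) (Φ (p.1 (-1)))
        (tangentMap 𝓘(ℝ, E) 𝓘(ℝ, E) (Φ (p.1 (-1))).symm p.2) = p.2 :=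
      tangentMap_symm_tangentMap (Φ (p.1 (-1))).symm p.2
    simp [h]

/-- The projection `T^ℤ × TM → T^ℤ × M`. -/
@[simps] noncomputable def basePoint (p : (ℤ → T) × TangentBundle 𝓘(ℝ, E) M) : ProdSpace T M :=
  ⟨p.1, p.2.proj⟩

theorem tangentSkew_zpow_fst (Φ : T → (M ≃ₘ^2⟮𝓘(ℝ, E), 𝓘(ℝ, E)⟯ M)) (n : ℤ)
    (p : (ℤ → T) × TangentBundle 𝓘(ℝ, E) M) (i : ℤ) :
    ((tangentSkew Φ ^ n) p).1 i = p.1 (i + n) := by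
  induction n generalizing p with
  | zero => simp
  | succ n ih =>
    rw [zpow_add_one, Equiv.Perm.mul_apply, ih]; simp [add_assoc]
  | pred n ih =>
    rw [zpow_sub_one, Equiv.Perm.mul_apply, ih]
    change p.1 (i + -(n : ℤ) - 1) = _
    rw [add_sub_assoc]

theorem contMDiff_iterFwd (Φ : T → (M ≃ₘ^2⟮𝓘(ℝ, E), 𝓘(ℝ, E)⟯ M)) (w : ℤ → T) (n : ℕ) :
    ContMDiff 𝓘(ℝ, E) 𝓘(ℝ, E) 2 (iterFwd Φ w n) := by
  induction n with
  | zero => exact contMDiff_id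
  | succ n ih => exact (Φ (w n)).contMDiff.comp ih

theorem contMDiff_iterBwd (Φ : T → (M ≃ₘ^2⟮𝓘(ℝ, E), 𝓘(ℝ, E)⟯ M)) (w : ℤ → T) (n : ℕ) :
    ContMDiff 𝓘(ℝ, E) 𝓘(ℝ, E) 2 (iterBwd Φ w n) := by
  induction n with
  | zero => exact contMDiff_id
  | succ n ih => exact (Φ (w (-((n : ℤ) + 1)))).symm.contMDiff.comp ih

theorem tangentSkew_pow_snd (Φ : T → (M ≃ₘ^2⟮𝓘(ℝ, E), 𝓘(ℝ, E)⟯ M)) (n : ℕ)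
    (p : (ℤ → T) × TangentBundle 𝓘(ℝ, E) M) :
    ((tangentSkew Φ ^ (n : ℤ)) p).2 = tangentMap 𝓘(ℝ, E) 𝓘(ℝ, E) (iterFwd Φ p.1 n) p.2 := by
  induction n with
  | zero => simp [iterFwd]
  | succ n ih =>
    rw [Nat.cast_succ, add_comm, zpow_one_add, Equiv.Perm.mul_apply, tangentSkew_apply, ih,
      tangentSkew_zpow_fst, iterFwd, tangentMap_comp ((Φ _).contMDiff.mdifferentiable two_ne_zero)
        ((contMDiff_iterFwd Φ _ n).mdifferentiable two_ne_zero), zero_add]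
    rfl

theorem tangentSkew_neg_snd (Φ : T → (M ≃ₘ^2⟮𝓘(ℝ, E), 𝓘(ℝ, E)⟯ M)) (n : ℕ)
    (p : (ℤ → T) × TangentBundle 𝓘(ℝ, E) M) :
    ((tangentSkew Φ ^ (-(n : ℤ))) p).2 =
      tangentMap 𝓘(ℝ, E) 𝓘(ℝ, E) (iterBwd Φ p.1 n) p.2 := by
  induction n with
  | zero => simp [iterBwd]
  | succ n ih =>
    have : -((n + 1 : ℕ) : ℤ) = -1 + -(n : ℤ) := by push_cast; ring
    rw [this, zpow_add, zpow_neg_one, Equiv.Perm.mul_apply]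
    change tangentMap _ _ (Φ (((tangentSkew Φ ^ (-(n : ℤ))) p).1 (-1))).symm _ = _
    rw [ih, tangentSkew_zpow_fst, iterBwd,
      tangentMap_comp ((Φ _).symm.contMDiff.mdifferentiable two_ne_zero)
        ((contMDiff_iterBwd Φ _ n).mdifferentiable two_ne_zero), neg_add_rev]
    rfl

/-- Lets the group law of a single permutation handle both time directions of `iter`. -/
theorem tangentSkew_zpow_snd (Φ : T → (M ≃ₘ^2⟮𝓘(ℝ, E), 𝓘(ℝ, E)⟯ M)) (n : ℤ)
    (p : (ℤ → T) × TangentBundle 𝓘(ℝ, E) M) :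
    ((tangentSkew Φ ^ n) p).2 = tangentMap 𝓘(ℝ, E) 𝓘(ℝ, E) (iter Φ p.1 n) p.2 := by
  match n with
  | Int.ofNat n => exact tangentSkew_pow_snd Φ n p
  | Int.negSucc n => exact tangentSkew_neg_snd Φ (n + 1) p

theorem continuous_tangentSkew_pow [IsManifold 𝓘(ℝ, E) ∞ M] [FiniteDimensional ℝ E]
    [TopologicalSpace T] {Φ : T → (M ≃ₘ^2⟮𝓘(ℝ, E), 𝓘(ℝ, E)⟯ M)} (hΦ : Continuous Φ) (n : ℕ) :
    Continuous (tangentSkew Φ ^ (n : ℤ)) := by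
  have h : Continuous (tangentSkew Φ) :=
    (continuous_pi fun i => (continuous_apply (i + 1)).comp continuous_fst).prodMk
      ((continuous_tangentMap_family hΦ).comp 
        (f := fun p : (ℤ → T) × TangentBundle 𝓘(ℝ, E) M => (p.1 0, p.2))
        (((continuous_apply 0).comp continuous_fst).prodMk continuous_snd))
  rw [zpow_natCast]
  induction n with
  | zero => exact continuous_id
  | succ n ih => rw [pow_succ]; exact ih.comp h

theorem continuous_basePoint [IsManifold 𝓘(ℝ, E) ∞ M] [TopologicalSpace T] :
    Continuous (basePoint : (ℤ → T) × TangentBundle 𝓘(ℝ, E) M → ProdSpace T M) :=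
  continuous_induced_rng.2
    (continuous_fst.prodMk ((FiberBundle.continuous_proj _ _).comp continuous_snd))

/-- The set of pairs `(ω, v)` with `ω ∈ Ω` and `v ∈ G(ω, x)`, where `x` is the base point
of `v`. -/
def lift (G : SubspaceField E T M) (Ω : Set (ℤ → T)) : Set ((ℤ → T) × TangentBundle 𝓘(ℝ, E) M) :=
  {p | p.1 ∈ Ω ∧ p.2.2 ∈ G (basePoint p)}

/-- If v₀ is not in the subspace, then v₀ together with a local frame is linearly independent.
Linear independence is an open condition in a trivialization, so nearby vectors over Ω are not in
the subspace either. -/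
theorem isClosed_lift [IsManifold 𝓘(ℝ, E) ∞ M] [FiniteDimensional ℝ E] [TopologicalSpace T] {G : SubspaceField E T M}
    {Ω : Set (ℤ → T)}
    (hΩ : IsClosed Ω) (hG : G.IsContinuousOn (fiberOver Ω)) : IsClosed (lift G Ω) := by
  refine isClosed_of_closure_subset fun p₀ hp₀ => ?_
  have hp₀Ω : p₀.1 ∈ Ω :=
    closure_minimal (fun p hp => hp.1) (hΩ.preimage continuous_fst) hp₀
  refine ⟨hp₀Ω, ?_⟩
  by_contra hv
  obtain ⟨U, hU, k, e, he, hspan⟩ := hG (basePoint p₀) hp₀Ω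
  set t := trivializationAt E (fun x : M => TangentSpace 𝓘(ℝ, E) x) p₀.2.proj
  set s : Set ((ℤ → T) × TangentBundle 𝓘(ℝ, E) M) := basePoint ⁻¹' (U ∩ fiberOver Ω)
  have hp₀s : basePoint p₀ ∈ U ∩ fiberOver Ω := ⟨mem_of_mem_nhds hU, hp₀Ω⟩
  -- Coordinates, in the one trivialization `t`, of the vector followed by the frame: tuples in
  -- different tangent spaces become tuples in E.
  let F : (ℤ → T) × TangentBundle 𝓘(ℝ, E) M → Fin (k + 1) → E := fun p =>
    Fin.cons (t p.2).2 fun i => (t ⟨p.2.proj, e i (basePoint p)⟩).2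
  have hlin : ∀ p : (ℤ → T) × TangentBundle 𝓘(ℝ, E) M, p.2.proj ∈ t.baseSet →
      F p = t.continuousLinearMapAt ℝ p.2.proj ∘
        (Fin.cons p.2.2 fun i => e i (basePoint p) : Fin (k + 1) → TangentSpace 𝓘(ℝ, E) p.2.proj)
      := by
    intro p hp
    ext i
    refine Fin.cases ?_ (fun i => ?_) i <;>
    simp only [F, Fin.cons_zero, Fin.cons_succ, Function.comp_apply,
      Trivialization.continuousLinearMapAt_apply, Trivialization.coe_linearMapAt_of_mem _ hp] <;> rfl
  have hF : ContinuousWithinAt F s p₀ := by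
    have h0 : ContinuousWithinAt (fun p : (ℤ → T) × TangentBundle 𝓘(ℝ, E) M => (t p.2).2) s p₀ :=
      ((FiberBundle.continuousWithinAt_totalSpace E _).1
        (continuous_snd (X := ℤ → T) (Y := TangentBundle 𝓘(ℝ, E) M)).continuousWithinAt).2
    have h1 : ∀ i, ContinuousWithinAt
        (fun p : (ℤ → T) × TangentBundle 𝓘(ℝ, E) M => (t ⟨p.2.proj, e i (basePoint p)⟩).2) s p₀ :=
      fun i => ((FiberBundle.continuousWithinAt_totalSpace E _).1
        (((he i) _ hp₀s).comp (t := U ∩ fiberOver Ω) continuous_basePoint.continuousWithinAt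
          (fun p hp => hp))).2
    refine continuousWithinAt_pi.2 fun i => ?_
    refine Fin.cases ?_ (fun i => ?_) i
    · exact h0
    · exact h1 i
  have hbase₀ : p₀.2.proj ∈ t.baseSet := FiberBundle.mem_baseSet_trivializationAt' _
  have hind₀ : LinearIndependent ℝ (F p₀) := by
    rw [hlin _ hbase₀]
    have hinj : LinearMap.ker (t.continuousLinearMapAt ℝ p₀.2.proj).toLinearMap = ⊥ := by
      rw [LinearMap.ker_eq_bot]
      have := (t.continuousLinearEquivAt ℝ _ hbase₀).injective
      rwa [Trivialization.coe_continuousLinearEquivAt_eq _ hbase₀] at this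
    refine LinearIndependent.map' ?_ _ hinj
    refine linearIndependent_finCons.2 ⟨(hspan _ hp₀s).1, ?_⟩
    have h := (hspan _ hp₀s).2
    exact fun h' => hv (h ▸ h')
  have hev : ∀ᶠ p in 𝓝[s] p₀, LinearIndependent ℝ (F p) :=
    hF.tendsto.eventually (LinearIndependent.eventually hind₀)
  have hevb : ∀ᶠ p : (ℤ → T) × TangentBundle 𝓘(ℝ, E) M in 𝓝[s] p₀, p.2.proj ∈ t.baseSet :=
    nhdsWithin_le_nhds (((FiberBundle.continuous_proj _ _).comp continuous_snd).continuousAt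
      (t.open_baseSet.mem_nhds hbase₀))
  have hevU : ∀ᶠ p in 𝓝 p₀, basePoint p ∈ U := continuous_basePoint.continuousAt hU
  have hall : ∀ᶠ p in 𝓝 p₀, p ∉ lift G Ω := by
    filter_upwards [eventually_nhdsWithin_iff.1 hev, eventually_nhdsWithin_iff.1 hevb, hevU]
      with p h1 h2 h3 hp
    have hps : p ∈ s := ⟨h3, hp.1⟩
    have h4 := h1 hps
    rw [hlin _ (h2 hps)] at h4
    have h5 := (linearIndependent_finCons.1
      (LinearIndependent.of_comp (t.continuousLinearMapAt ℝ p.2.proj).toLinearMap h4)).2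
    have h := (hspan _ hps).2
    exact h5 (h ▸ hp.2)
  exact (mem_closure_iff_frequently.1 hp₀) hall

end

/-! ### The Riemannian norm and compactness of disc bundles. -/

section Norm

variable {E : Type*} [NormedAddCommGroup E] [NormedSpace ℝ E]
  {M : Type*} [TopologicalSpace M] [ChartedSpace E M] [IsManifold 𝓘(ℝ, E) ∞ M]
  [RiemannianBundle (fun x : M => TangentSpace 𝓘(ℝ, E) x)]
  {T : Type*}

/-- The Riemannian norm of a tangent vector. -/
noncomputable def fiberNorm (v : TangentBundle 𝓘(ℝ, E) M) : ℝ := ‖v.2‖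

section
variable [IsContinuousRiemannianBundle E (fun x : M => TangentSpace 𝓘(ℝ, E) x)]

theorem continuous_fiberNorm :
    Continuous (fiberNorm : TangentBundle 𝓘(ℝ, E) M → ℝ) := by
  have h : Continuous fun v : TangentBundle 𝓘(ℝ, E) M => inner ℝ v.2 v.2 :=
    Continuous.inner_bundle (F := E) (E := fun x : M => TangentSpace 𝓘(ℝ, E) x)
      (b := fun v : TangentBundle 𝓘(ℝ, E) M => v.proj) (v := fun v => v.2) (w := fun v => v.2)
      continuous_id continuous_id
  have h2 : (fiberNorm : TangentBundle 𝓘(ℝ, E) M → ℝ) = fun v => √(inner ℝ v.2 v.2) := by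
    ext v
    exact norm_eq_sqrt_real_inner v.2
  rw [h2]
  exact h.sqrt

/-- An ultrafilter on the disc bundle has a limiting base point x. In the trivialization at x the
fibre coordinates stay in a ball of E, hence converge as well. -/
theorem isCompact_fiberNorm_le [FiniteDimensional ℝ E] [CompactSpace M] (R : ℝ) :
    IsCompact {v : TangentBundle 𝓘(ℝ, E) M | fiberNorm v ≤ R} := by
  rw [isCompact_iff_ultrafilter_le_nhds]
  intro f hf
  obtain ⟨x, -, hx⟩ := isCompact_iff_ultrafilter_le_nhds.1 (isCompact_univ (X := M))
    (f.map (TotalSpace.proj : TangentBundle 𝓘(ℝ, E) M → M)) (by simp)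
  replace hx : Tendsto (TotalSpace.proj : TangentBundle 𝓘(ℝ, E) M → M) f (𝓝 x) := hx
  set e := trivializationAt E (fun x : M => TangentSpace 𝓘(ℝ, E) x) x
  obtain ⟨C, hC, hCx⟩ := eventually_norm_trivializationAt_lt E
    (fun x : M => TangentSpace 𝓘(ℝ, E) x) x
  have hbase : ∀ᶠ v in (f : Filter (TangentBundle 𝓘(ℝ, E) M)), v.proj ∈ e.baseSet :=
    hx.eventually (e.open_baseSet.mem_nhds (FiberBundle.mem_baseSet_trivializationAt' x))
  have hball : ∀ᶠ v in (f : Filter (TangentBundle 𝓘(ℝ, E) M)),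
      (e v).2 ∈ Metric.closedBall (0 : E) (C * R) := by
    filter_upwards [hbase, hx.eventually hCx, hf (mem_principal_self _)] with v hv hCv hR
    rw [mem_closedBall_zero_iff]
    have h1 : e.continuousLinearMapAt ℝ v.proj v.2 = (e v).2 := by
      rw [Trivialization.continuousLinearMapAt_apply, Trivialization.coe_linearMapAt_of_mem _ hv]
    rw [← h1]
    exact (ContinuousLinearMap.le_opNorm _ _).trans
      (mul_le_mul hCv.le hR (norm_nonneg _) hC.le)
  obtain ⟨y, -, hy⟩ := isCompact_iff_ultrafilter_le_nhds.1 (isCompact_closedBall (0 : E) (C * R))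
    (f.map fun v => (e v).2) (by rw [le_principal_iff]; exact hball)
  replace hy : Tendsto (fun v => (e v).2) f (𝓝 y) := hy
  have hxy : (x, y) ∈ e.target := by
    rw [e.mem_target]; exact FiberBundle.mem_baseSet_trivializationAt' x
  have hlim : Tendsto (fun v : TangentBundle 𝓘(ℝ, E) M => e.toOpenPartialHomeomorph.symm
      (v.proj, (e v).2)) f (𝓝 (e.toOpenPartialHomeomorph.symm (x, y))) :=
    (e.toOpenPartialHomeomorph.symm.continuousAt hxy).tendsto.comp (hx.prodMk_nhds hy)
  have hlim' : (f : Filter (TangentBundle 𝓘(ℝ, E) M)) ≤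
      𝓝 (e.toOpenPartialHomeomorph.symm (x, y)) := by
    refine (hlim.congr' ?_ : Tendsto id _ _)
    filter_upwards [hbase] with v hv
    have hv' : v ∈ e.source := e.mem_source.2 hv
    have h2 : (v.proj, (e v).2) = e v := by
      rw [← e.coe_fst hv']
    rw [h2]
    exact e.toOpenPartialHomeomorph.left_inv hv'
  refine ⟨_, ?_, hlim'⟩
  exact (isClosed_le continuous_fiberNorm continuous_const).mem_of_tendsto (f := id)
    (b := (f : Filter (TangentBundle 𝓘(ℝ, E) M))) (tendsto_id.mono_left hlim')
    (Filter.eventually_iff.2 (hf (mem_principal_self _)))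

end

end Norm
end RandomPert

/-! ### The noise space as a product, and invariance under the skew product. -/

namespace RandomPert

section

variable {T : Type*} [MetricSpace T] [MeasurableSpace T] [BorelSpace T]

/-- Every neighbourhood contains a finite open cylinder, whose measure is a finite product of
positive numbers. The product form gives compactness by Tychonoff and invariance under the shift in
both directions. -/
theorem noiseSpace_eq_pi (θ : ℝ → ProbabilityMeasure T) (ε : ℝ) :
    noiseSpace θ ε = univ.pi fun _ => (θ ε : Measure T).support := by
  ext w
  simp only [noiseSpace, mem_univ_pi, Measure.mem_support_iff_forall]
  constructor
  · intro h i U hU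
    obtain ⟨V, hVU, hV, hwV⟩ := mem_nhds_iff.1 hU
    have h1 := h ((fun w => w i) ⁻¹' V)
      ((continuous_apply i).continuousAt.preimage_mem_nhds (hV.mem_nhds hwV))
    have h2 := (measurePreserving_eval_infinitePi (fun _ : ℤ => (θ ε : Measure T)) i).measure_preimage
      hV.measurableSet.nullMeasurableSet
    exact (h2 ▸ h1 :).trans_le (measure_mono hVU)
  · intro h U hU
    rw [nhds_pi, Filter.mem_pi'] at hU
    obtain ⟨I, t, ht, hIU⟩ := hU
    refine lt_of_lt_of_le ?_ (measure_mono hIU)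
    have hsub : (I : Set ℤ).pi (fun i => interior (t i)) ⊆ (I : Set ℤ).pi t :=
      pi_mono fun i _ => interior_subset
    refine lt_of_lt_of_le ?_ (measure_mono hsub)
    rw [Measure.infinitePi_pi _ fun i _ => isOpen_interior.measurableSet]
    exact pos_iff_ne_zero.2 (Finset.prod_ne_zero_iff.2 fun i _ =>
      (h i _ (interior_mem_nhds.2 (ht i))).ne')

end

section

variable {E : Type*} [NormedAddCommGroup E] [NormedSpace ℝ E]
  {M : Type*} [TopologicalSpace M] [ChartedSpace E M]
  {T : Type*}

theorem skew_zpow_mem_fiberOver {Φ : T → (M ≃ₘ^2⟮𝓘(ℝ, E), 𝓘(ℝ, E)⟯ M)} {K : Set T}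
    {z : ProdSpace T M} (hz : z ∈ fiberOver (univ.pi fun _ => K)) (n : ℤ) :
    (skew Φ ^ n) z ∈ fiberOver (univ.pi fun _ => K) := by
  induction n generalizing z with
  | zero => exact hz
  | succ n ih =>
    rw [zpow_add_one]
    exact ih fun i _ => hz (i + 1) trivial
  | pred n ih =>
    rw [zpow_sub_one]
    exact ih fun i _ => hz (i - 1) trivial

theorem continuous_skew [IsManifold 𝓘(ℝ, E) ∞ M] [FiniteDimensional ℝ E]
    [TopologicalSpace T] {Φ : T → (M ≃ₘ^2⟮𝓘(ℝ, E), 𝓘(ℝ, E)⟯ M)} (hΦ : Continuous Φ) :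
    Continuous (skew Φ) := by
  have h : Continuous fun z : ProdSpace T M => (z.noise, z.pt) := continuous_induced_dom
  exact continuous_induced_rng.2 ((continuous_pi fun i => (continuous_apply (i + 1)).comp h.fst).prodMk
    ((continuous_eval_family hΦ).comp (((continuous_apply 0).comp h.fst).prodMk h.snd)))

theorem continuous_skew_symm [IsManifold 𝓘(ℝ, E) ∞ M] [FiniteDimensional ℝ E] [T2Space M]
    [CompactSpace M] [TopologicalSpace T] {Φ : T → (M ≃ₘ^2⟮𝓘(ℝ, E), 𝓘(ℝ, E)⟯ M)}
    (hΦ : Continuous Φ) : Continuous (skew Φ).symm := by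
  have h : Continuous fun z : ProdSpace T M => (z.noise, z.pt) := continuous_induced_dom
  have hs : Continuous fun p : T × M => (Φ p.1).symm p.2 := by
    refine continuous_iff_isClosed.2 fun C hC => ?_
    -- The preimage of C under (ω, x) ↦ f_ω⁻¹(x) is the projection of this closed set along the
    -- compact factor M, hence closed.
    have h1 : IsClosed {q : (T × M) × M | q.2 ∈ C ∧ Φ q.1.1 q.2 = q.1.2} :=
      (hC.preimage continuous_snd).inter (isClosed_eq ((continuous_eval_family hΦ).comp
        (continuous_fst.fst.prodMk continuous_snd)) continuous_fst.snd)
    convert isClosedMap_fst_of_compactSpace _ h1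
    ext p
    simp only [mem_preimage, mem_image]
    constructor
    · intro hp
      exact ⟨(p, (Φ p.1).symm p.2), ⟨hp, (Φ p.1).apply_symm_apply _⟩, rfl⟩
    · rintro ⟨q, ⟨hq, hq'⟩, rfl⟩
      rw [← hq', (Φ q.1.1).symm_apply_apply]
      exact hq
  exact continuous_induced_rng.2 ((continuous_pi fun i => (continuous_apply (i - 1)).comp h.fst).prodMk
    (hs.comp (((continuous_apply (-1)).comp h.fst).prodMk h.snd)))

theorem tangentSkew_zpow_mem_lift {Φ : T → (M ≃ₘ^2⟮𝓘(ℝ, E), 𝓘(ℝ, E)⟯ M)} {K : Set T}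
    {G : SubspaceField E T M}
    (hG : ∀ z ∈ fiberOver (M := M) (univ.pi fun _ => K),
      (G z).map (mfderiv 𝓘(ℝ, E) 𝓘(ℝ, E) (Φ (z.noise 0)) z.pt).toLinearMap = G (skew Φ z))
    (n : ℤ) (p : (ℤ → T) × TangentBundle 𝓘(ℝ, E) M) :
    (tangentSkew Φ ^ n) p ∈ lift G (univ.pi fun _ => K) ↔ p ∈ lift G (univ.pi fun _ => K) := by
  have key : ∀ p, tangentSkew Φ p ∈ lift G (univ.pi fun _ => K) ↔
      p ∈ lift G (univ.pi fun _ => K) := by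
    intro p
    constructor
    · rintro ⟨h1, h2⟩
      have h1' : p.1 ∈ univ.pi fun _ => K := fun i _ => by
        have := h1 (i - 1) trivial
        simpa using this
      refine ⟨h1', ?_⟩
      have h3 := hG (basePoint p) h1'
      have h4 : (tangentSkew Φ p).2.2 ∈ G (skew Φ (basePoint p)) := h2
      rw [← h3] at h4
      obtain ⟨u, hu, hu'⟩ := h4
      have h5 : tangentSkew Φ (p.1, ⟨p.2.proj, u⟩) = tangentSkew Φ p :=
        Prod.ext rfl (congrArg (TotalSpace.mk _) hu')
      have h6 := (tangentSkew Φ).injective h5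
      rw [← h6]
      exact hu
    · rintro ⟨h1, h2⟩
      refine ⟨fun i _ => h1 (i + 1) trivial, ?_⟩
      change _ ∈ G (skew Φ (basePoint p))
      rw [← hG (basePoint p) h1]
      exact ⟨_, h2, rfl⟩
  induction n generalizing p with
  | zero => rfl
  | succ n ih =>
    rw [zpow_add_one, Equiv.Perm.mul_apply]
    exact (ih _).trans (key p)
  | pred n ih =>
    rw [zpow_sub_one, Equiv.Perm.mul_apply]
    refine (ih _).trans ((key _).symm.trans ?_)
    rw [← Equiv.Perm.mul_apply, mul_inv_cancel, Equiv.Perm.one_apply]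

end

/-! ### Uniform derivative bounds and compactness of the bad sets. -/

section Norm

variable {E : Type*} [NormedAddCommGroup E] [NormedSpace ℝ E]
  {M : Type*} [TopologicalSpace M] [ChartedSpace E M]
  [RiemannianBundle (fun x : M => TangentSpace 𝓘(ℝ, E) x)]
  {T : Type*}

theorem fiberNorm_tangentMap_smul (g : M → M) (x : M) (c : ℝ) (v : TangentSpace 𝓘(ℝ, E) x) :
    fiberNorm (tangentMap 𝓘(ℝ, E) 𝓘(ℝ, E) g ⟨x, c • v⟩) =
      |c| * fiberNorm (tangentMap 𝓘(ℝ, E) 𝓘(ℝ, E) g ⟨x, v⟩) := by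
  change ‖mfderiv 𝓘(ℝ, E) 𝓘(ℝ, E) g x (c • v)‖ = |c| * ‖mfderiv 𝓘(ℝ, E) 𝓘(ℝ, E) g x v‖
  rw [map_smul, norm_smul, Real.norm_eq_abs]

/-- On the compact unit sphere bundle over K, the norm of the image is bounded and never zero; the
bound on its reciprocal controls the inverse derivatives. -/
theorem exists_fiberNorm_tangentMap_le [IsManifold 𝓘(ℝ, E) ∞ M] [FiniteDimensional ℝ E]
    [CompactSpace M] [IsContinuousRiemannianBundle E (fun x : M => TangentSpace 𝓘(ℝ, E) x)]
    [TopologicalSpace T] {Φ : T → (M ≃ₘ^2⟮𝓘(ℝ, E), 𝓘(ℝ, E)⟯ M)} (hΦ : Continuous Φ)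
    {K : Set T} (hK : IsCompact K) :
    ∃ L : ℝ, 1 ≤ L ∧ ∀ a ∈ K, ∀ v,
      fiberNorm (tangentMap 𝓘(ℝ, E) 𝓘(ℝ, E) (Φ a) v) ≤ L * fiberNorm v ∧
      fiberNorm (tangentMap 𝓘(ℝ, E) 𝓘(ℝ, E) (Φ a).symm v) ≤ L * fiberNorm v := by
  set Q : Set (T × TangentBundle 𝓘(ℝ, E) M) := K ×ˢ {v | fiberNorm v = 1}
  have hS : IsCompact {v : TangentBundle 𝓘(ℝ, E) M | fiberNorm v = 1} :=
    (isCompact_fiberNorm_le 1).of_isClosed_subset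
      (isClosed_eq continuous_fiberNorm continuous_const) fun v hv => le_of_eq hv
  have hQ : IsCompact Q := hK.prod hS
  set g : T × TangentBundle 𝓘(ℝ, E) M → ℝ :=
    fun p => fiberNorm (tangentMap 𝓘(ℝ, E) 𝓘(ℝ, E) (Φ p.1) p.2)
  have hg : Continuous g := continuous_fiberNorm.comp (continuous_tangentMap_family hΦ)
  have hpos : ∀ p ∈ Q, g p ≠ 0 := by
    intro p hp h0
    have h1 : (tangentMap 𝓘(ℝ, E) 𝓘(ℝ, E) (Φ p.1) p.2).2 = 0 := norm_eq_zero.1 h0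
    have h2 := congrArg fiberNorm (tangentMap_symm_tangentMap (Φ p.1) p.2)
    have h3 : fiberNorm (tangentMap 𝓘(ℝ, E) 𝓘(ℝ, E) (Φ p.1).symm
        (tangentMap 𝓘(ℝ, E) 𝓘(ℝ, E) (Φ p.1) p.2)) = 0 := by
      change ‖mfderiv 𝓘(ℝ, E) 𝓘(ℝ, E) (Φ p.1).symm _
        (tangentMap 𝓘(ℝ, E) 𝓘(ℝ, E) (Φ p.1) p.2).2‖ = 0
      rw [h1, map_zero, norm_zero]
    have h4 : fiberNorm p.2 = 1 := hp.2
    rw [h3, h4] at h2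
    exact zero_ne_one h2
  obtain ⟨L₁, hL₁⟩ := hQ.bddAbove_image hg.continuousOn
  obtain ⟨L₂, hL₂⟩ := hQ.bddAbove_image (hg.continuousOn.inv₀ hpos)
  have hnn : ∀ v : TangentBundle 𝓘(ℝ, E) M, 0 ≤ fiberNorm v := fun v => norm_nonneg _
  have main : ∀ a ∈ K, ∀ v, g (a, v) ≤ L₁ * fiberNorm v ∧ fiberNorm v ≤ L₂ * g (a, v) := by
    intro a ha v
    have hsm : ∀ c : ℝ, g (a, ⟨v.proj, c • v.2⟩) = |c| * g (a, v) := fun c =>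
      fiberNorm_tangentMap_smul _ _ _ _
    rcases (hnn v).eq_or_lt with h0 | h0
    · have h1 : v.2 = 0 := norm_eq_zero.1 h0.symm
      have h2 := hsm 0
      rw [zero_smul, ← h1, abs_zero, zero_mul] at h2
      have h3 : g (a, v) = 0 := h2
      rw [h3, ← h0]
      simp
    · have hu : (a, (⟨v.proj, (fiberNorm v)⁻¹ • v.2⟩ : TangentBundle 𝓘(ℝ, E) M)) ∈ Q := by
        refine ⟨ha, ?_⟩
        change ‖(fiberNorm v)⁻¹ • v.2‖ = 1
        rw [norm_smul, Real.norm_eq_abs, abs_of_pos (inv_pos.2 h0)]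
        exact inv_mul_cancel₀ h0.ne'
      have b1 := hL₁ (mem_image_of_mem _ hu)
      have b2 := hL₂ (mem_image_of_mem _ hu)
      have hne := hpos _ hu
      have hval := hsm (fiberNorm v)⁻¹
      rw [abs_of_pos (inv_pos.2 h0)] at hval
      simp only [Pi.inv_apply, hval] at b1 b2 hne
      have hgpos : 0 < g (a, v) := lt_of_le_of_ne (hnn _) fun h => hne (by rw [← h, mul_zero])
      constructor
      · rwa [inv_mul_le_iff₀ h0, mul_comm] at b1
      · rwa [mul_inv, inv_inv, ← div_eq_mul_inv, div_le_iff₀ hgpos] at b2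
  refine ⟨max 1 (max L₁ L₂), le_max_left _ _, fun a ha v => ⟨?_, ?_⟩⟩
  · exact (main a ha v).1.trans (mul_le_mul_of_nonneg_right
      ((le_max_left _ _).trans (le_max_right _ _)) (hnn _))
  · have h1 := (main a ha (tangentMap 𝓘(ℝ, E) 𝓘(ℝ, E) (Φ a).symm v)).2
    have h2 : tangentMap 𝓘(ℝ, E) 𝓘(ℝ, E) (Φ a)
        (tangentMap 𝓘(ℝ, E) 𝓘(ℝ, E) (Φ a).symm v) = v := tangentMap_symm_tangentMap (Φ a).symm v
    simp only [g, h2] at h1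
    exact h1.trans (mul_le_mul_of_nonneg_right
      ((le_max_right _ _).trans (le_max_right _ _)) (hnn _))

theorem fiberNorm_tangentSkew_zpow_le {Φ : T → (M ≃ₘ^2⟮𝓘(ℝ, E), 𝓘(ℝ, E)⟯ M)} {K : Set T} {L : ℝ}
    (hL : 1 ≤ L) (hΦL : ∀ a ∈ K, ∀ v,
      fiberNorm (tangentMap 𝓘(ℝ, E) 𝓘(ℝ, E) (Φ a) v) ≤ L * fiberNorm v ∧
      fiberNorm (tangentMap 𝓘(ℝ, E) 𝓘(ℝ, E) (Φ a).symm v) ≤ L * fiberNorm v)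
    {p : (ℤ → T) × TangentBundle 𝓘(ℝ, E) M} (hp : p.1 ∈ univ.pi fun _ => K) (n : ℤ) :
    fiberNorm ((tangentSkew Φ ^ n) p).2 ≤ L ^ n.natAbs * fiberNorm p.2 := by
  have hL0 : 0 ≤ L := zero_le_one.trans hL
  induction n with
  | zero => simp
  | succ n ih =>
    rw [add_comm, zpow_one_add, Equiv.Perm.mul_apply]
    refine ((hΦL (((tangentSkew Φ ^ (n : ℤ)) p).1 0) ?_ _).1).trans ?_
    · rw [tangentSkew_zpow_fst]; exact hp _ trivial
    · refine (mul_le_mul_of_nonneg_left ih hL0).trans (le_of_eq ?_)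
      have : (1 + (n : ℤ)).natAbs = n + 1 := by omega
      rw [this, Int.natAbs_natCast, pow_succ]
      ring
  | pred n ih =>
    have h : -(n : ℤ) - 1 = -1 + -(n : ℤ) := by ring
    rw [h, zpow_add, zpow_neg_one, Equiv.Perm.mul_apply]
    refine ((hΦL (((tangentSkew Φ ^ (-(n : ℤ))) p).1 (-1)) ?_ _).2).trans ?_
    · rw [tangentSkew_zpow_fst]; exact hp _ trivial
    · refine (mul_le_mul_of_nonneg_left ih hL0).trans (le_of_eq ?_)
      have : (-1 + -(n : ℤ)).natAbs = n + 1 := by omega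
      rw [this, Int.natAbs_neg, Int.natAbs_natCast, pow_succ]
      ring

theorem restrNorm_le {Φ : T → (M ≃ₘ^2⟮𝓘(ℝ, E), 𝓘(ℝ, E)⟯ M)} {G : SubspaceField E T M}
    {Ω : Set (ℤ → T)} {n : ℤ} {z : ProdSpace T M} (hz : z ∈ fiberOver Ω) {c : ℝ} (hc : 0 ≤ c)
    (h : ∀ p ∈ lift G Ω, basePoint p = z → fiberNorm p.2 = 1 →
      fiberNorm ((tangentSkew Φ ^ n) p).2 ≤ c) : restrNorm Φ G n z ≤ c := by
  refine ContinuousLinearMap.opNorm_le_of_unit_norm hc fun v hv => ?_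
  have := h (z.noise, ⟨z.pt, v⟩) ⟨hz, v.2⟩ rfl hv
  rw [tangentSkew_zpow_snd] at this
  exact this

theorem fiberNorm_tangentSkew_le_restrNorm {Φ : T → (M ≃ₘ^2⟮𝓘(ℝ, E), 𝓘(ℝ, E)⟯ M)}
    {G : SubspaceField E T M} {Ω : Set (ℤ → T)} (n : ℤ)
    {p : (ℤ → T) × TangentBundle 𝓘(ℝ, E) M} (hp : p ∈ lift G Ω) (h1 : fiberNorm p.2 = 1) :
    fiberNorm ((tangentSkew Φ ^ n) p).2 ≤ restrNorm Φ G n (basePoint p) := by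
  rw [tangentSkew_zpow_snd]
  have := ((mfderiv 𝓘(ℝ, E) 𝓘(ℝ, E) (iter Φ p.1 n) p.2.proj).comp
    (G (basePoint p)).subtypeL).le_opNorm ⟨p.2.2, hp.2⟩
  have h2 : ‖(⟨p.2.2, hp.2⟩ : G (basePoint p))‖ = 1 := h1
  rw [h2, mul_one] at this
  exact this

/-- The points over `Ω` at which some unit vector in `G` is mapped by `Df_ω^n` to a vector of norm
at least `c`. -/
def badSet (Φ : T → (M ≃ₘ^2⟮𝓘(ℝ, E), 𝓘(ℝ, E)⟯ M)) (G : SubspaceField E T M) (Ω : Set (ℤ → T))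
    (n : ℤ) (c : ℝ) : Set (ProdSpace T M) :=
  basePoint '' {p | p ∈ lift G Ω ∧ fiberNorm p.2 = 1 ∧ c ≤ fiberNorm ((tangentSkew Φ ^ n) p).2}

/-- Both conditions on the unit vector are closed, and everything stays in a disc bundle over a
compact base. -/
theorem isCompact_badSet [IsManifold 𝓘(ℝ, E) ∞ M] [FiniteDimensional ℝ E] [CompactSpace M]
    [IsContinuousRiemannianBundle E (fun x : M => TangentSpace 𝓘(ℝ, E) x)]
    [TopologicalSpace T] [T2Space T] {Φ : T → (M ≃ₘ^2⟮𝓘(ℝ, E), 𝓘(ℝ, E)⟯ M)} (hΦ : Continuous Φ)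
    {K : Set T} (hK : IsCompact K) {G : SubspaceField E T M}
    (hGc : G.IsContinuousOn (fiberOver (univ.pi fun _ => K)))
    (hG : ∀ z ∈ fiberOver (M := M) (univ.pi fun _ => K),
      (G z).map (mfderiv 𝓘(ℝ, E) 𝓘(ℝ, E) (Φ (z.noise 0)) z.pt).toLinearMap = G (skew Φ z))
    (n : ℤ) (c : ℝ) : IsCompact (badSet Φ G (univ.pi fun _ => K) n c) := by
  have hΩ : IsCompact (univ.pi fun _ : ℤ => K) := isCompact_univ_pi fun _ => hK
  have hlift := isClosed_lift hΩ.isClosed hGc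
  have hbdd : ∀ R : ℝ, IsCompact {p : (ℤ → T) × TangentBundle 𝓘(ℝ, E) M |
      p.1 ∈ univ.pi (fun _ : ℤ => K) ∧ fiberNorm p.2 ≤ R} := fun R =>
    hΩ.prod (isCompact_fiberNorm_le R)
  have hnorm : Continuous fun p : (ℤ → T) × TangentBundle 𝓘(ℝ, E) M => fiberNorm p.2 :=
    continuous_fiberNorm.comp continuous_snd
  refine IsCompact.image ?_ continuous_basePoint
  obtain ⟨k, rfl | rfl⟩ := n.eq_nat_or_neg
  · refine (hbdd 1).of_isClosed_subset ?_ fun p hp => ⟨hp.1.1, hp.2.1.le⟩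
    exact hlift.inter ((isClosed_eq hnorm continuous_const).inter
      (isClosed_le continuous_const (hnorm.comp (continuous_tangentSkew_pow hΦ k))))
  · obtain ⟨L, hL, hΦL⟩ := exists_fiberNorm_tangentMap_le hΦ hK
    -- For negative times the vectors are parametrised by their images q under the backward cocycle,
    -- so only the continuous forward cocycle is needed; q has norm at most L^k.
    have hcpt : IsCompact {q | q ∈ lift G (univ.pi fun _ => K) ∧
        fiberNorm ((tangentSkew Φ ^ (k : ℤ)) q).2 = 1 ∧ c ≤ fiberNorm q.2} := by
      refine (hbdd (L ^ k)).of_isClosed_subset ?_ fun q hq => ⟨hq.1.1, ?_⟩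
      · exact hlift.inter ((isClosed_eq (hnorm.comp (continuous_tangentSkew_pow hΦ k))
          continuous_const).inter (isClosed_le continuous_const hnorm))
      · have h1 := fiberNorm_tangentSkew_zpow_le hL hΦL
          (((tangentSkew_zpow_mem_lift hG (k : ℤ) q).2 hq.1).1) (-(k : ℤ))
        rw [← Equiv.Perm.mul_apply, ← zpow_add, hq.2.1, mul_one] at h1
        simpa using h1
    convert hcpt.image (continuous_tangentSkew_pow hΦ k) using 1
    ext p
    constructor
    · rintro ⟨h1, h2, h3⟩
      have h4 : (tangentSkew Φ ^ (k : ℤ)) ((tangentSkew Φ ^ (-(k : ℤ))) p) = p := by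
        rw [← Equiv.Perm.mul_apply, ← zpow_add, add_neg_cancel, zpow_zero, Equiv.Perm.one_apply]
      exact ⟨_, ⟨(tangentSkew_zpow_mem_lift hG _ p).2 h1, by rw [h4]; exact h2, h3⟩, h4⟩
    · rintro ⟨q, ⟨h1, h2, h3⟩, rfl⟩
      have h4 : (tangentSkew Φ ^ (-(k : ℤ))) ((tangentSkew Φ ^ (k : ℤ)) q) = q := by
        rw [← Equiv.Perm.mul_apply, ← zpow_add, neg_add_cancel, zpow_zero, Equiv.Perm.one_apply]
      exact ⟨(tangentSkew_zpow_mem_lift hG _ q).2 h1, h2, by rw [h4]; exact h3⟩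

end Norm
end RandomPert

/-! ### From visits to the bad set to products of norms. -/

namespace RandomPert

theorem ExpRateLT.eventually_lt {a : ℕ → ℝ} {b : ℝ} (h : ExpRateLT a b) :
    ∀ᶠ n : ℕ in atTop, a n < Real.exp (b * n) := by
  obtain ⟨c, hc, hlim⟩ := h
  filter_upwards [hlim.eventually (gt_mem_nhds hc), eventually_gt_atTop 0] with n hn hn0
  by_contra! hle
  have h1 : ((b * n : ℝ) : EReal) ≤ ENNReal.log (ENNReal.ofReal (a n)) := by
    have h2 := ENNReal.log_monotone (ENNReal.ofReal_le_ofReal hle)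
    rwa [ENNReal.log_ofReal_of_pos (Real.exp_pos _), Real.log_exp] at h2
  have h3 : ((1 / n : ℝ) : EReal) * ((b * n : ℝ) : EReal) ≤
      ((1 / n : ℝ) : EReal) * ENNReal.log (ENNReal.ofReal (a n)) :=
    mul_le_mul_of_nonneg_left h1 (by exact_mod_cast (by positivity : (0 : ℝ) ≤ 1 / n))
  have h4 : ((1 / n : ℝ) : EReal) * ((b * n : ℝ) : EReal) = (b : EReal) := by
    rw [← EReal.coe_mul]
    congr 1
    field_simp
  rw [h4] at h3
  exact absurd hn (not_lt.2 h3)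

section

variable {T M : Type*} [TopologicalSpace T] [TopologicalSpace M]

theorem isEmbedding_prodSpace :
    Topology.IsEmbedding fun z : ProdSpace T M => (z.noise, z.pt) :=
  ⟨⟨rfl⟩, fun _ _ h => ProdSpace.ext (congrArg Prod.fst h) (congrArg Prod.snd h)⟩

/-- Serves the portmanteau inequality and makes compact bad sets closed. -/
theorem metrizableSpace_prodSpace {T M : Type*} [MetricSpace T] [TopologicalSpace M]
    [TopologicalSpace.MetrizableSpace M] : TopologicalSpace.MetrizableSpace (ProdSpace T M) := by
  have : TopologicalSpace.MetrizableSpace (ℤ → T) := inferInstance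
  exact isEmbedding_prodSpace.metrizableSpace

end

section

variable {E : Type*} [NormedAddCommGroup E] [NormedSpace ℝ E]
  {M : Type*} [TopologicalSpace M] [ChartedSpace E M]
  {T : Type*}

theorem iterate_skew_zpow (Φ : T → (M ≃ₘ^2⟮𝓘(ℝ, E), 𝓘(ℝ, E)⟯ M)) (m : ℤ) (i : ℕ) :
    (⇑(skew Φ ^ m))^[i] = ⇑(skew Φ ^ ((i : ℤ) * m)) := by
  rw [mul_comm, zpow_mul, zpow_natCast, Equiv.Perm.iterate_eq_pow]

theorem measurePreserving_skew_zpow [IsManifold 𝓘(ℝ, E) ∞ M] [FiniteDimensional ℝ E] [T2Space M]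
    [CompactSpace M] [TopologicalSpace T] {Φ : T → (M ≃ₘ^2⟮𝓘(ℝ, E), 𝓘(ℝ, E)⟯ M)}
    (hΦ : Continuous Φ) {ν : Measure (ProdSpace T M)} (hν : MeasurePreserving (skew Φ) ν ν)
    (m : ℤ) : MeasurePreserving ⇑(skew Φ ^ m) ν ν := by
  have hinv : MeasurePreserving ⇑(skew Φ)⁻¹ ν ν :=
    hν.symm (Homeomorph.mk (skew Φ) (continuous_skew hΦ)
      (continuous_skew_symm hΦ)).toMeasurableEquiv
  induction m with
  | zero => exact MeasurePreserving.id ν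
  | succ n ih => rw [zpow_add_one]; exact ih.comp hν
  | pred n ih => rw [zpow_sub_one]; exact ih.comp hinv

end

section

variable {E : Type*} [NormedAddCommGroup E] [NormedSpace ℝ E]
  {M : Type*} [TopologicalSpace M] [ChartedSpace E M]
  [RiemannianBundle (fun x : M => TangentSpace 𝓘(ℝ, E) x)]
  {T : Type*}

/-- The exponent is |m| log L on D, the trivial bound, and −β|m| off D, where no unit vector is bad.
Splitting off −α leaves exactly the function fed to the maximal inequality. -/
theorem restrNorm_le_exp {Φ : T → (M ≃ₘ^2⟮𝓘(ℝ, E), 𝓘(ℝ, E)⟯ M)} {K : Set T} {L : ℝ}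
    (hL : 1 ≤ L) (hΦL : ∀ a ∈ K, ∀ v,
      fiberNorm (tangentMap 𝓘(ℝ, E) 𝓘(ℝ, E) (Φ a) v) ≤ L * fiberNorm v ∧
      fiberNorm (tangentMap 𝓘(ℝ, E) 𝓘(ℝ, E) (Φ a).symm v) ≤ L * fiberNorm v)
    (G : SubspaceField E T M) (α β : ℝ) (m : ℤ) {D : Set (ProdSpace T M)}
    (hD : badSet Φ G (univ.pi fun _ => K) m (Real.exp (-β * m.natAbs)) ⊆ D)
    {y : ProdSpace T M} (hy : y ∈ fiberOver (univ.pi fun _ => K)) :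
    restrNorm Φ G m y ≤
      Real.exp (m.natAbs * ((D.indicator (fun _ => Real.log L + β) y - (β - α)) - α)) := by
  refine restrNorm_le hy (Real.exp_pos _).le fun p hp hpy hp1 => ?_
  by_cases hyD : y ∈ D
  · rw [indicator_of_mem hyD]
    have h1 := fiberNorm_tangentSkew_zpow_le hL hΦL hp.1 m
    rw [hp1, mul_one] at h1
    refine h1.trans (le_of_eq ?_)
    rw [← Real.rpow_natCast, Real.rpow_def_of_pos (by linarith)]
    congr 1
    ring
  · rw [indicator_of_notMem hyD]
    by_contra! hlt
    refine hyD (hD ⟨p, ⟨hp, hp1, le_trans (le_of_eq ?_) hlt.le⟩, hpy⟩)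
    congr 1
    ring

theorem restrNorm_nonneg (Φ : T → (M ≃ₘ^2⟮𝓘(ℝ, E), 𝓘(ℝ, E)⟯ M)) (G : SubspaceField E T M) (n : ℤ)
    (z : ProdSpace T M) : 0 ≤ restrNorm Φ G n z :=
  ContinuousLinearMap.opNorm_nonneg _

theorem prod_restrNorm_le {Φ : T → (M ≃ₘ^2⟮𝓘(ℝ, E), 𝓘(ℝ, E)⟯ M)} {K : Set T} {L : ℝ}
    (hL : 1 ≤ L) (hΦL : ∀ a ∈ K, ∀ v,
      fiberNorm (tangentMap 𝓘(ℝ, E) 𝓘(ℝ, E) (Φ a) v) ≤ L * fiberNorm v ∧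
      fiberNorm (tangentMap 𝓘(ℝ, E) 𝓘(ℝ, E) (Φ a).symm v) ≤ L * fiberNorm v)
    (G : SubspaceField E T M) (α β : ℝ) (m : ℤ) {z : ProdSpace T M}
    (hz : z ∈ fiberOver (univ.pi fun _ => K)) (n : ℕ) {D : Set (ProdSpace T M)}
    (hD : badSet Φ G (univ.pi fun _ => K) m (Real.exp (-β * m.natAbs)) ⊆ D)
    (hN : birkhoffSum ⇑(skew Φ ^ m) (fun y => D.indicator (fun _ => Real.log L + β) y - (β - α)) n z
      ≤ 0) :
    ∏ i ∈ Finset.range n, restrNorm Φ G m ((skew Φ ^ ((i : ℤ) * m)) z) ≤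
      Real.exp (-α * m.natAbs * n) := by
  have hstep : ∀ y ∈ fiberOver (M := M) (univ.pi fun _ => K), restrNorm Φ G m y ≤
      Real.exp (m.natAbs * ((D.indicator (fun _ => Real.log L + β) y - (β - α)) - α)) :=
    fun y hy => restrNorm_le_exp hL hΦL G α β m hD hy
  have hle := Finset.prod_le_prod (s := Finset.range n)
    (fun i _ => restrNorm_nonneg Φ G m ((skew Φ ^ ((i : ℤ) * m)) z))
    fun i _ => hstep _ (skew_zpow_mem_fiberOver hz ((i : ℤ) * m))
  simp only [birkhoffSum, iterate_skew_zpow] at hN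
  refine hle.trans ?_
  generalize hu : (fun i : ℕ => D.indicator (fun _ => Real.log L + β)
    ((skew Φ ^ ((i : ℤ) * m)) z) - (β - α)) = u
  have hu' := fun i => congrFun hu i
  simp only [hu'] at hN ⊢
  clear hle hstep
  rw [← Real.exp_sum, Real.exp_le_exp, ← Finset.mul_sum, Finset.sum_sub_distrib,
    Finset.sum_const, Finset.card_range, nsmul_eq_mul]
  have h0 : (0 : ℝ) ≤ m.natAbs := Nat.cast_nonneg _
  have h1 := mul_nonneg h0 (neg_nonneg.2 hN)
  linarith

theorem ExpRateLT.eventually_notMem_badSet {Φ : T → (M ≃ₘ^2⟮𝓘(ℝ, E), 𝓘(ℝ, E)⟯ M)} {Ω : Set (ℤ → T)}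
    {G : SubspaceField E T M} {b : ℝ} {z : ProdSpace T M} {m : ℕ → ℤ}
    (h : ExpRateLT (fun n => restrNorm Φ G (m n) z) b) :
    ∀ᶠ n : ℕ in atTop, z ∉ badSet Φ G Ω (m n) (Real.exp (b * n)) := by
  filter_upwards [h.eventually_lt] with n hn
  rintro ⟨p, ⟨hp, hp1, hc⟩, rfl⟩
  exact absurd (hc.trans (fiberNorm_tangentSkew_le_restrNorm _ hp hp1)) (not_le.2 hn)

end
end RandomPert

/-! ### Proof of the theorem. -/

open RandomPert in
theorem mainTheorem3
    {E : Type*} [NormedAddCommGroup E] [NormedSpace ℝ E] [FiniteDimensional ℝ E]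
    {M : Type*} [TopologicalSpace M] [T2Space M] [CompactSpace M]
    [ChartedSpace E M] [IsManifold 𝓘(ℝ, E) ∞ M]
    [RiemannianBundle (fun x : M => TangentSpace 𝓘(ℝ, E) x)]
    [IsContMDiffRiemannianBundle 𝓘(ℝ, E) ∞ E (fun x : M => TangentSpace 𝓘(ℝ, E) x)]
    {T : Type*} [MetricSpace T] [MeasurableSpace T] [BorelSpace T]
    (f : M ≃ₘ^2⟮𝓘(ℝ, E), 𝓘(ℝ, E)⟯ M)
    (Φ : T → (M ≃ₘ^2⟮𝓘(ℝ, E), 𝓘(ℝ, E)⟯ M)) (ωf : T) (θ : ℝ → ProbabilityMeasure T)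
    (hpert : RandomPert.IsRandomPerturbation f Φ ωf θ)
    (ε₀ : ℝ) (hε₀ : 0 < ε₀)
    (Ecu Ecs : RandomPert.SubspaceField E T M)
    (hsplit : RandomPert.IsRandomDominatedSplitting Φ (RandomPert.noiseSpace θ ε₀) Ecu Ecs)
    (α β : ℝ) (hα : 0 < α) (hαβ : α < β)
    (μs : ℕ → ProbabilityMeasure (RandomPert.ProdSpace T M))
    (μ : ProbabilityMeasure (RandomPert.ProdSpace T M))
    (hinv : ∀ n, MeasurePreserving (RandomPert.skew Φ)
      (μs n : Measure (RandomPert.ProdSpace T M)) (μs n : Measure (RandomPert.ProdSpace T M)))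
    (hcarried : ∀ n, ∀ᵐ z ∂(μs n : Measure (RandomPert.ProdSpace T M)),
      z ∈ RandomPert.fiberOver (M := M) (RandomPert.noiseSpace θ ε₀))
    (hlim : Tendsto μs atTop (𝓝 μ))
    (hrate : ∀ᵐ z ∂(μ : Measure (RandomPert.ProdSpace T M)),
      RandomPert.ExpRateLT (fun n => RandomPert.restrNorm Φ Ecs (n : ℤ) z) (-β) ∧
      RandomPert.ExpRateLT (fun n => RandomPert.restrNorm Φ Ecu (-(n : ℤ)) z) (-β)) :
    Tendsto (fun ℓ : ℕ => liminf (fun n : ℕ => (μs n : Measure (RandomPert.ProdSpace T M))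
      (RandomPert.hypBlock Φ (RandomPert.noiseSpace θ ε₀) Ecu Ecs α ℓ)) atTop)
      atTop (𝓝 (1 : ℝ≥0∞)) := by
  have : IsContinuousRiemannianBundle E (fun x : M => TangentSpace 𝓘(ℝ, E) x) := by
    obtain ⟨g, hg, hgv⟩ := ‹IsContMDiffRiemannianBundle 𝓘(ℝ, E) ∞ E
      (fun x : M => TangentSpace 𝓘(ℝ, E) x)›.exists_contMDiff
    exact ⟨g, hg.continuous, hgv⟩
  have : TopologicalSpace.MetrizableSpace M := Manifold.metrizableSpace 𝓘(ℝ, E) M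
  have : TopologicalSpace.MetrizableSpace (ProdSpace T M) := metrizableSpace_prodSpace
  have hΦ := hpert.continuous
  have hK := hpert.isCompact_support ε₀ hε₀
  rw [noiseSpace_eq_pi] at *
  set K := (θ ε₀ : Measure T).support
  obtain ⟨L, hL, hΦL⟩ := exists_fiberNorm_tangentMap_le hΦ hK
  set Ω : Set (ℤ → T) := univ.pi fun _ => K
  let D : ℕ → Set (ProdSpace T M) := fun ℓ =>
    badSet Φ Ecs Ω (ℓ : ℤ) (Real.exp (-β * ℓ)) ∪ badSet Φ Ecu Ω (-(ℓ : ℤ)) (Real.exp (-β * ℓ))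
  have hDc : ∀ ℓ, IsClosed (D ℓ) := fun ℓ =>
    ((isCompact_badSet hΦ hK hsplit.continuous_cs hsplit.invariant_cs _ _).union
      (isCompact_badSet hΦ hK hsplit.continuous_cu hsplit.invariant_cu _ _)).isClosed
  have hDlim : Tendsto (fun ℓ => (μ : Measure (ProdSpace T M)) (D ℓ)) atTop (𝓝 0) := by
    have h := tendsto_measure_of_ae_tendsto_indicator_of_isFiniteMeasure (L := atTop)
      (μ := (μ : Measure (ProdSpace T M))) (As := D) MeasurableSet.empty
      (fun ℓ => (hDc ℓ).measurableSet) (by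
        filter_upwards [hrate] with z hz
        filter_upwards [ExpRateLT.eventually_notMem_badSet (Ω := Ω) hz.1,
          ExpRateLT.eventually_notMem_badSet (Ω := Ω) hz.2] with ℓ h1 h2
        simp only [mem_empty_iff_false, iff_false]
        exact fun h => h.elim h1 h2)
    rwa [measure_empty] at h
  -- The constant of the maximal inequality, doubled to account for the two time directions.
  set c : ℝ≥0∞ := 2 * ENNReal.ofReal ((Real.log L + β) / (β - α))
  have hc : c ≠ ⊤ := ENNReal.mul_ne_top ENNReal.ofNat_ne_top ENNReal.ofReal_ne_top
  have hb : 0 ≤ Real.log L + β := by linarith [Real.log_nonneg hL]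
  have hmain : ∀ ℓ n, 1 - c * (μs n : Measure (ProdSpace T M)) (D ℓ) ≤
      (μs n : Measure (ProdSpace T M)) (hypBlock Φ Ω Ecu Ecs α ℓ) := by
    intro ℓ n
    set ν : Measure (ProdSpace T M) := (μs n : Measure (ProdSpace T M))
    let N : ℤ → Set (ProdSpace T M) := fun m => {z | ∃ k, 0 < birkhoffSum ⇑(skew Φ ^ m)
      (fun y => (D ℓ).indicator (fun _ => Real.log L + β) y - (β - α)) k z}
    have hN : ∀ m, ν (N m) ≤ ENNReal.ofReal ((Real.log L + β) / (β - α)) * ν (D ℓ) := fun m =>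
      measure_exists_birkhoffSum_indicator_pos_le (measurePreserving_skew_zpow hΦ (hinv n) m)
        (hDc ℓ).measurableSet (sub_pos.2 hαβ) hb
    have hcover : ∀ z ∈ fiberOver (M := M) Ω, z ∉ N ℓ → z ∉ N (-ℓ) →
        z ∈ hypBlock Φ Ω Ecu Ecs α ℓ := by
      intro z hz h1 h2
      refine ⟨hz, fun k => ⟨?_, ?_⟩⟩
      · exact prod_restrNorm_le hL hΦL Ecs α β ℓ hz k (D := D ℓ) subset_union_left
          (not_lt.1 fun h => h1 ⟨k, h⟩)
      · have h3 := prod_restrNorm_le hL hΦL Ecu α β (-ℓ) hz k (D := D ℓ)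
          (by rw [Int.natAbs_neg]; exact subset_union_right) (not_lt.1 fun h => h2 ⟨k, h⟩)
        simpa only [Int.natAbs_neg, Int.natAbs_natCast, mul_neg] using h3
    -- Almost every point lies in the block or in an exceptional set, so subadditivity gives the
    -- lower bound without measurability of the block.
    rw [tsub_le_iff_right]
    calc (1 : ℝ≥0∞) = ν univ := measure_univ.symm
      _ ≤ ν (hypBlock Φ Ω Ecu Ecs α ℓ ∪ (N ℓ ∪ N (-ℓ))) := by
        refine measure_mono_ae ?_
        filter_upwards [hcarried n] with z hz _
        by_cases h1 : z ∈ N ℓ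
        · exact Or.inr (Or.inl h1)
        by_cases h2 : z ∈ N (-ℓ)
        · exact Or.inr (Or.inr h2)
        exact Or.inl (hcover z hz h1 h2)
      _ ≤ ν (hypBlock Φ Ω Ecu Ecs α ℓ) + (ν (N ℓ) + ν (N (-ℓ))) :=
        (measure_union_le _ _).trans (add_le_add le_rfl (measure_union_le _ _))
      _ ≤ ν (hypBlock Φ Ω Ecu Ecs α ℓ) + c * ν (D ℓ) := by
        simp only [c, two_mul, add_mul]
        exact add_le_add le_rfl (add_le_add (hN _) (hN _))
  refine tendsto_order.2 ⟨fun x hx => ?_, fun x hx => Eventually.of_forall fun ℓ => ?_⟩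
  · have hcont : Tendsto (fun r : ℝ≥0∞ => 1 - c * r) (𝓝[>] 0) (𝓝 1) := by
      have h1 : Tendsto (fun r : ℝ≥0∞ => c * r) (𝓝[>] 0) (𝓝 (c * 0)) :=
        (ENNReal.Tendsto.const_mul tendsto_id (Or.inr hc)).mono_left nhdsWithin_le_nhds
      have h2 := ENNReal.Tendsto.sub (tendsto_const_nhds (x := (1 : ℝ≥0∞))) h1
        (Or.inl ENNReal.one_ne_top)
      simpa using h2
    -- r > 0 is chosen with 1 − c·r > x; then μ(D_ℓ) < r for large ℓ, and for each such ℓ, μ_n(D_ℓ)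
    -- < r for large n.
    obtain ⟨r, hr, hr0⟩ := ((hcont.eventually (lt_mem_nhds hx)).and self_mem_nhdsWithin).exists
    filter_upwards [hDlim.eventually (gt_mem_nhds hr0)] with ℓ hℓ
    have h1 := (ProbabilityMeasure.limsup_measure_closed_le_of_tendsto hlim (hDc ℓ)).trans_lt hℓ
    refine hr.trans_le (le_liminf_of_le (by isBoundedDefault) ?_)
    filter_upwards [eventually_lt_of_limsup_lt h1] with n hn
    exact (tsub_le_tsub_left (mul_le_mul_right hn.le c) 1).trans (hmain ℓ n)
  · refine lt_of_le_of_lt (liminf_le_of_le (by isBoundedDefault) fun b hb => ?_) hx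
    obtain ⟨n, hn⟩ := hb.exists
    exact hn.trans prob_le_one
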